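/- Theorem 6.10 (Polynomial approximation). Let $n,p\ge 0$ and let $(M,\mathcal{A})$ be a $\mathbb{Z}_2^n$-supermanifold of dimension $p|\mathbf{q}$, that is, a second-countable Hausdorff space $M$ with a sheaf $\mathcal{A}$ of $\mathbb{Z}_2^n$-graded associative unital $\mathbb{R}$-algebras satisfying $ab=(-1)^{\langle \deg a,\deg b\rangle}ba$ for homogeneous $a,b$ (where $\langle\cdot,\cdot\rangle$ is the standard scalar product of $\mathbb{Z}_2^n$), each of whose stalks $\mathcal{A}_m$ has a unique maximal homogeneous ideal $\mathfrak{m}_m$, and which is locally isomorphic, as a ringed space of $\mathbb{Z}_2^n$-graded algebras, to a superdomain: an open subset $V\subset\mathbb{R}^p$ with the sheaf $W\mapsto C^\infty(W)[[\xi^1,\dots,\xi^q]]$ of formal power series in indeterminates $\xi^a$ of nonzero degrees $\sigma_a\in\mathbb{Z}_2^n$, with $\xi^a\xi^b=(-1)^{\langle\sigma_a,\sigma_b\rangle}\xi^b\xi^a$, where $\mathbf{q}$ records how many of the $\xi^a$ have each nonzero degree. Let $m\in M$, let $U$ be an open neighbourhood of $m$, let $f\in\mathcal{A}(U)$, and let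 $k\ge 1$ be an integer. Let $(x,\xi)=(x^1,\dots,x^p,\xi^1,\dots,\xi^q)$ be the coordinates of any chart around $m$, with image $V\subset\mathbb{R}^p$. Then there is a formal series $$P(x,\xi)=\sum_{\mu} P_\mu(x)\,\xi^\mu\in C^\infty(V)[[\xi^1,\dots,\xi^q]],$$ each of whose coefficients $P_\mu$ is a polynomial in the centered coordinates $x^i-x^i(m)$, such that, identifying $P$ with its pullback under the chart, $$[f]_m-[P]_m\in\mathfrak{m}_m^k ,$$ where $[\,\cdot\,]_m$ denotes the germ at $m$. -/

import Mathlib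

open TopologicalSpace
open scoped Manifold ContDiff

universe u v

noncomputable section

namespace Z2n

/-! ### The grading group and the sign rule -/

/-- The grading group `ℤ₂ⁿ`. -/
abbrev Deg (n : ℕ) := Fin n → ZMod 2

/-- The sign `(-1) ^ ⟨i, j⟩`, where `⟨i, j⟩ = i₁ j₁ + ⋯ + iₙ jₙ`. -/
def sign {n : ℕ} (i j : Deg n) : ℤˣ := (-1 : ℤˣ) ^ (∑ k, i k * j k)

/-! ### Formal power series in graded indeterminates -/

section FormalSeries

variable {n q : ℕ}

/-- Exponents `μ` of the standard monomials `ξ^μ = (ξ^1)^{μ_1} ⋯ (ξ^q)^{μ_q}`: an odd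
indeterminate, that is one whose degree has odd coordinate sum, occurs with exponent at most `1`
(it anticommutes with itself, so its square vanishes). -/
def Admissible (σ : Fin q → Deg n) (μ : Fin q →₀ ℕ) : Prop :=
  ∀ a, ∑ k, σ a k = 1 → μ a ≤ 1

/-- The sign in `ξ^α ξ^β = ± ξ^(α+β)`: each `ξ^b` of the second factor is moved to the left past
each `ξ^a` of the first factor with `b < a`. -/
def monoSign (σ : Fin q → Deg n) (α β : Fin q →₀ ℕ) : ℤˣ :=
  ∏ a, ∏ b, if b < a then sign (σ a) (σ b) ^ (α a * β b) else 1

/-- Families of coefficients of formal series `∑ f_μ ξ^μ` in standard monomials. -/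
def seriesSubmodule (σ : Fin q → Deg n) (R : Type v) [CommRing R] :
    Submodule R ((Fin q →₀ ℕ) → R) where
  carrier := {f | ∀ μ, ¬ Admissible σ μ → f μ = 0}
  add_mem' := fun {f g} hf hg μ h => by simp [hf μ h, hg μ h]
  zero_mem' := fun _ _ => rfl
  smul_mem' := fun c f hf μ h => by simp [hf μ h]

/-- `R[[ξ^1, …, ξ^q]]_σ`: formal power series with coefficients in the (central) commutative ring
`R`, in indeterminates `ξ^a` of degree `σ a` subject to
`ξ^a ξ^b = (-1) ^ ⟨σ a, σ b⟩ ξ^b ξ^a`. -/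
def FormalSeries (σ : Fin q → Deg n) (R : Type v) [CommRing R] : Type v := seriesSubmodule σ R

namespace FormalSeries

variable {σ : Fin q → Deg n} {R : Type v} [CommRing R]

instance : AddCommGroup (FormalSeries σ R) := inferInstanceAs (AddCommGroup (seriesSubmodule σ R))

instance {S : Type*} [CommRing S] [Algebra S R] : Module S (FormalSeries σ R) :=
  inferInstanceAs (Module S (seriesSubmodule σ R))

/-- The coefficient `f_μ` of `ξ^μ`; it is `0` if `ξ^μ` is not a standard monomial. -/
def coeff (f : FormalSeries σ R) (μ : Fin q →₀ ℕ) : R := f.1 μ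

theorem coeff_of_not_admissible (f : FormalSeries σ R) {μ : Fin q →₀ ℕ} (h : ¬ Admissible σ μ) :
    f.coeff μ = 0 := f.2 μ h

@[ext] theorem ext {f g : FormalSeries σ R} (h : ∀ μ, Admissible σ μ → f.coeff μ = g.coeff μ) :
    f = g := by
  apply Subtype.ext
  funext μ
  by_cases hμ : Admissible σ μ
  · exact h μ hμ
  · rw [f.2 μ hμ, g.2 μ hμ]

open Classical in
/-- The series with given coefficients at the standard monomials. -/
def mk (c : (Fin q →₀ ℕ) → R) : FormalSeries σ R :=
  ⟨fun μ => if Admissible σ μ then c μ else 0, fun _ h => if_neg h⟩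

theorem coeff_mk (c : (Fin q →₀ ℕ) → R) {μ : Fin q →₀ ℕ} (h : Admissible σ μ) :
    (mk c : FormalSeries σ R).coeff μ = c μ := if_pos h

@[simp] theorem coeff_add (f g : FormalSeries σ R) (μ : Fin q →₀ ℕ) :
    (f + g).coeff μ = f.coeff μ + g.coeff μ := rfl

@[simp] theorem coeff_zero (μ : Fin q →₀ ℕ) : (0 : FormalSeries σ R).coeff μ = 0 := rfl

@[simp] theorem coeff_smul {S : Type*} [CommRing S] [Algebra S R] (c : S)
    (f : FormalSeries σ R) (μ : Fin q →₀ ℕ) : (c • f).coeff μ = c • f.coeff μ := rfl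

instance : One (FormalSeries σ R) := ⟨mk fun μ => if μ = 0 then 1 else 0⟩

/-- The product determined by `ξ^α ξ^β = ± ξ^(α+β)`. -/
instance : Mul (FormalSeries σ R) :=
  ⟨fun f g => mk fun μ => ∑ x ∈ Finset.HasAntidiagonal.antidiagonal μ,
    ((monoSign σ x.1 x.2 : ℤ) : R) * f.coeff x.1 * g.coeff x.2⟩

theorem coeff_one {μ : Fin q →₀ ℕ} (h : Admissible σ μ) :
    (1 : FormalSeries σ R).coeff μ = if μ = 0 then 1 else 0 := coeff_mk _ h

theorem coeff_mul (f g : FormalSeries σ R) {μ : Fin q →₀ ℕ} (h : Admissible σ μ) :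
    (f * g).coeff μ = ∑ x ∈ Finset.HasAntidiagonal.antidiagonal μ,
      ((monoSign σ x.1 x.2 : ℤ) : R) * f.coeff x.1 * g.coeff x.2 := coeff_mk _ h

theorem monoSign_zero_left (σ : Fin q → Deg n) (β : Fin q →₀ ℕ) : monoSign σ 0 β = 1 := by
  simp [monoSign]

theorem monoSign_zero_right (σ : Fin q → Deg n) (α : Fin q →₀ ℕ) : monoSign σ α 0 = 1 := by
  simp [monoSign]

theorem monoSign_add_left (σ : Fin q → Deg n) (α β γ : Fin q →₀ ℕ) :
    monoSign σ (α + β) γ = monoSign σ α γ * monoSign σ β γ := by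
  simp only [monoSign, ← Finset.prod_mul_distrib]
  refine Finset.prod_congr rfl fun a _ => Finset.prod_congr rfl fun b _ => ?_
  split_ifs <;> simp [add_mul, pow_add]

theorem monoSign_add_right (σ : Fin q → Deg n) (α β γ : Fin q →₀ ℕ) :
    monoSign σ α (β + γ) = monoSign σ α β * monoSign σ α γ := by
  simp only [monoSign, ← Finset.prod_mul_distrib]
  refine Finset.prod_congr rfl fun a _ => Finset.prod_congr rfl fun b _ => ?_
  split_ifs <;> simp [mul_add, pow_add]

theorem admissible_left {μ : Fin q →₀ ℕ} (h : Admissible σ μ)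
    {x : (Fin q →₀ ℕ) × (Fin q →₀ ℕ)} (hx : x ∈ Finset.HasAntidiagonal.antidiagonal μ) : Admissible σ x.1 := by
  intro a ha
  have := h a ha
  rw [← Finset.HasAntidiagonal.mem_antidiagonal.1 hx, Finsupp.add_apply] at this
  omega

theorem admissible_right {μ : Fin q →₀ ℕ} (h : Admissible σ μ)
    {x : (Fin q →₀ ℕ) × (Fin q →₀ ℕ)} (hx : x ∈ Finset.HasAntidiagonal.antidiagonal μ) : Admissible σ x.2 := by
  intro a ha
  have := h a ha
  rw [← Finset.HasAntidiagonal.mem_antidiagonal.1 hx, Finsupp.add_apply] at this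
  omega

protected theorem mul_assoc (f g h : FormalSeries σ R) : f * g * h = f * (g * h) := by
  ext μ hμ
  rw [coeff_mul _ _ hμ, coeff_mul _ _ hμ]
  have e1 : ∀ x ∈ Finset.HasAntidiagonal.antidiagonal μ,
      ((monoSign σ x.1 x.2 : ℤ) : R) * (f * g).coeff x.1 * h.coeff x.2 =
      ∑ y ∈ Finset.HasAntidiagonal.antidiagonal x.1, ((monoSign σ x.1 x.2 : ℤ) : R) *
        (((monoSign σ y.1 y.2 : ℤ) : R) * f.coeff y.1 * g.coeff y.2) * h.coeff x.2 := by
    intro x hx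
    rw [coeff_mul _ _ (admissible_left hμ hx), Finset.mul_sum, Finset.sum_mul]
  have e2 : ∀ x ∈ Finset.HasAntidiagonal.antidiagonal μ,
      ((monoSign σ x.1 x.2 : ℤ) : R) * f.coeff x.1 * (g * h).coeff x.2 =
      ∑ y ∈ Finset.HasAntidiagonal.antidiagonal x.2, ((monoSign σ x.1 x.2 : ℤ) : R) * f.coeff x.1 *
        (((monoSign σ y.1 y.2 : ℤ) : R) * g.coeff y.1 * h.coeff y.2) := by
    intro x hx
    rw [coeff_mul _ _ (admissible_right hμ hx), Finset.mul_sum]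
  rw [Finset.sum_congr rfl e1, Finset.sum_congr rfl e2, Finset.sum_sigma', Finset.sum_sigma']
  refine Finset.sum_nbij' (fun z => ⟨(z.2.1, z.2.2 + z.1.2), (z.2.2, z.1.2)⟩)
    (fun z => ⟨(z.1.1 + z.2.1, z.2.2), (z.1.1, z.2.1)⟩) ?_ ?_ ?_ ?_ ?_
  · rintro ⟨⟨a, b⟩, ⟨c, d⟩⟩ hz
    simp only [Finset.mem_sigma, Finset.HasAntidiagonal.mem_antidiagonal] at hz ⊢
    exact ⟨by rw [← add_assoc, hz.2, hz.1], trivial⟩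
  · rintro ⟨⟨a, b⟩, ⟨c, d⟩⟩ hz
    simp only [Finset.mem_sigma, Finset.HasAntidiagonal.mem_antidiagonal] at hz ⊢
    exact ⟨by rw [add_assoc, hz.2, hz.1], trivial⟩
  · rintro ⟨⟨a, b⟩, ⟨c, d⟩⟩ hz
    simp only [Finset.mem_sigma, Finset.HasAntidiagonal.mem_antidiagonal] at hz ⊢
    obtain ⟨_, rfl⟩ := hz
    rfl
  · rintro ⟨⟨a, b⟩, ⟨c, d⟩⟩ hz
    simp only [Finset.mem_sigma, Finset.HasAntidiagonal.mem_antidiagonal] at hz ⊢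
    obtain ⟨_, rfl⟩ := hz
    rfl
  · rintro ⟨⟨a, b⟩, ⟨c, d⟩⟩ hz
    simp only [Finset.mem_sigma, Finset.HasAntidiagonal.mem_antidiagonal] at hz ⊢
    obtain ⟨_, rfl⟩ := hz
    rw [monoSign_add_left, monoSign_add_right]
    push_cast
    ring

instance : Ring (FormalSeries σ R) where
  __ := (inferInstance : AddCommGroup (FormalSeries σ R))
  mul_assoc := FormalSeries.mul_assoc
  left_distrib f g h := by
    ext μ hμ
    simp only [coeff_mul _ _ hμ, coeff_add, ← Finset.sum_add_distrib, mul_add]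
  right_distrib f g h := by
    ext μ hμ
    simp only [coeff_mul _ _ hμ, coeff_add, ← Finset.sum_add_distrib, mul_add, add_mul]
  zero_mul f := by
    ext μ hμ
    simp [coeff_mul _ _ hμ]
  mul_zero f := by
    ext μ hμ
    simp [coeff_mul _ _ hμ]
  one_mul f := by
    ext μ hμ
    rw [coeff_mul _ _ hμ, Finset.sum_eq_single (0, μ)]
    · rw [coeff_one (by intro a _; simp)]
      simp [monoSign_zero_left]
    · rintro ⟨a, b⟩ hx hne
      rw [coeff_one (admissible_left hμ hx), if_neg, mul_zero, zero_mul]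
      rintro rfl
      exact hne (by simpa using hx)
    · intro hx
      simp at hx
  mul_one f := by
    ext μ hμ
    rw [coeff_mul _ _ hμ, Finset.sum_eq_single (μ, 0)]
    · rw [coeff_one (by intro a _; simp)]
      simp [monoSign_zero_right]
    · rintro ⟨a, b⟩ hx hne
      rw [coeff_one (admissible_right hμ hx), if_neg, mul_zero]
      rintro rfl
      exact hne (by simpa using hx)
    · intro hx
      simp at hx

instance {S : Type*} [CommRing S] [Algebra S R] : Algebra S (FormalSeries σ R) :=
  Algebra.ofModule
    (fun c f g => by
      ext μ hμ
      simp only [coeff_mul _ _ hμ, coeff_smul, Finset.smul_sum, mul_smul_comm, smul_mul_assoc])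
    (fun c f g => by
      ext μ hμ
      simp only [coeff_mul _ _ hμ, coeff_smul, Finset.smul_sum, mul_smul_comm])

/-- Homogeneous series of degree `d`: only monomials `ξ^μ` with `∑ μ_a σ_a = d` occur. -/
def HasDegree (f : FormalSeries σ R) (d : Deg n) : Prop :=
  ∀ μ, f.coeff μ ≠ 0 → ∑ a, μ a • σ a = d

/-- Apply a ring homomorphism to the coefficients. -/
def map {S : Type*} [CommRing S] (φ : R →+* S) (f : FormalSeries σ R) : FormalSeries σ S :=
  ⟨fun μ => φ (f.coeff μ), fun μ h => by simp [f.coeff_of_not_admissible h]⟩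

end FormalSeries

end FormalSeries

/-! ### Superdomains -/

/-- `C^∞(W)` for an open subset `W` of `ℝᵖ`. -/
abbrev Smooth {p : ℕ} (W : Opens (EuclideanSpace ℝ (Fin p))) : Type :=
  ContMDiffMap (𝓡 p) 𝓘(ℝ, ℝ) W ℝ ∞

/-- Restriction of functions `C^∞(W)[[ξ]] → C^∞(W')[[ξ]]` for `W' ⊆ W`. -/
def restrictSeries {n p q : ℕ} {σ : Fin q → Deg n} {W' W : Opens (EuclideanSpace ℝ (Fin p))}
    (h : W' ≤ W) : FormalSeries σ (Smooth W) → FormalSeries σ (Smooth W') :=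
  FormalSeries.map (ContMDiffMap.restrictRingHom (𝓡 p) 𝓘(ℝ, ℝ) ℝ h)

/-- The series `P(x, ξ)` is polynomial in the coordinates `x - x₀` centred at `x₀`, in the sense that
each coefficient is; infinitely many monomials `ξ^μ` may occur, and the
polynomial degrees of the coefficients need not be bounded. -/
def IsPolynomialAt {n p q : ℕ} {σ : Fin q → Deg n} {W : Opens (EuclideanSpace ℝ (Fin p))}
    (x₀ : EuclideanSpace ℝ (Fin p)) (P : FormalSeries σ (Smooth W)) : Prop :=
  ∀ μ, ∃ Q : MvPolynomial (Fin p) ℝ, ∀ x : W,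
    P.coeff μ x = MvPolynomial.eval (fun i => (x : EuclideanSpace ℝ (Fin p)) i - x₀ i) Q

/-! ### Ringed spaces -/

/-- A sheaf of `ℤ₂ⁿ`-commutative associative unital `ℝ`-algebras on `M`. -/
structure RingedSpace (n : ℕ) (M : Type u) [TopologicalSpace M] where
  /-- sections over an open set -/
  sec : Opens M → Type v
  [ring : ∀ U, Ring (sec U)]
  [algebra : ∀ U, Algebra ℝ (sec U)]
  /-- homogeneous sections of a given degree -/
  deg : ∀ U, Deg n → Submodule ℝ (sec U)
  one_mem : ∀ U, (1 : sec U) ∈ deg U 0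
  mul_mem : ∀ {U i j} {a b : sec U}, a ∈ deg U i → b ∈ deg U j → a * b ∈ deg U (i + j)
  isInternal : ∀ U, DirectSum.IsInternal (deg U)
  comm : ∀ {U i j} {a b : sec U}, a ∈ deg U i → b ∈ deg U j → a * b = (sign i j : ℤ) • (b * a)
  /-- restriction maps -/
  res : ∀ {U V : Opens M}, U ≤ V → sec V →ₐ[ℝ] sec U
  res_mem : ∀ {U V : Opens M} (h : U ≤ V) {d} {a : sec V}, a ∈ deg V d → res h a ∈ deg U d
  res_self : ∀ {U : Opens M} (a : sec U), res le_rfl a = a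
  res_res : ∀ {U V W : Opens M} (h : U ≤ V) (h' : V ≤ W) (a : sec W),
    res h (res h' a) = res (h.trans h') a
  existsUnique_glue : ∀ {ι : Type u} (U : ι → Opens M) (s : ∀ i, sec (U i)),
    (∀ i j, res (inf_le_left : U i ⊓ U j ≤ U i) (s i) =
      res (inf_le_right : U i ⊓ U j ≤ U j) (s j)) →
    ∃! t : sec (⨆ i, U i), ∀ i, res (le_iSup U i) t = s i

attribute [instance] RingedSpace.ring RingedSpace.algebra

namespace RingedSpace

variable {n : ℕ} {M : Type u} [TopologicalSpace M] (X : RingedSpace.{u, v} n M)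

/-- Sections over open neighbourhoods of `m`, directed by reverse inclusion. -/
abbrev nhdsSec (m : M) (U : (OpenNhdsOf m)ᵒᵈ) : Type v := X.sec (OrderDual.ofDual U).toOpens

/-- The transition maps of the system of sections over neighbourhoods of `m`. -/
abbrev nhdsRes (m : M) (U V : (OpenNhdsOf m)ᵒᵈ) (h : U ≤ V) :
    X.nhdsSec m U →ₐ[ℝ] X.nhdsSec m V :=
  X.res h

instance (m : M) : DirectedSystem (X.nhdsSec m) (X.nhdsRes m · · ·) where
  map_self _ a := X.res_self a
  map_map _ _ _ _ _ a := X.res_res _ _ a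

/-- The stalk at `m`. -/
abbrev Stalk (m : M) : Type _ := DirectLimit (X.nhdsSec m) (X.nhdsRes m)

/-- The germ `[f]_m`. -/
def germ {U : Opens M} {m : M} (hm : m ∈ U) (f : X.sec U) : X.Stalk m :=
  Quotient.mk _ ⟨OrderDual.toDual (⟨U, hm⟩ : OpenNhdsOf m), f⟩

/-- Homogeneous germs are the germs of homogeneous sections. -/
def IsHomogeneousGerm {m : M} (a : X.Stalk m) : Prop :=
  ∃ (U : Opens M) (hm : m ∈ U) (d : Deg n), ∃ f ∈ X.deg U d, X.germ hm f = a

/-- Homogeneous (two-sided) ideals of the stalk: those generated by homogeneous elements. -/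
def IsHomogeneousIdeal {m : M} (I : Ideal (X.Stalk m)) : Prop :=
  I.IsTwoSided ∧ I = Ideal.span {a | a ∈ I ∧ X.IsHomogeneousGerm a}

/-- Maximal elements among the proper homogeneous ideals of the stalk. -/
def IsMaximalHomogeneous {m : M} (I : Ideal (X.Stalk m)) : Prop :=
  Maximal (fun J : Ideal (X.Stalk m) => X.IsHomogeneousIdeal J ∧ J ≠ ⊤) I

/-- The open subset `φ⁻¹(W)` of the source of a partial homeomorphism. -/
def preim {p : ℕ} (φ : OpenPartialHomeomorph M (EuclideanSpace ℝ (Fin p)))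
    (W : Opens (EuclideanSpace ℝ (Fin p))) : Opens M :=
  ⟨φ.source ∩ φ ⁻¹' W, φ.isOpen_inter_preimage W.isOpen⟩

theorem preim_mono {p : ℕ} (φ : OpenPartialHomeomorph M (EuclideanSpace ℝ (Fin p)))
    {W' W : Opens (EuclideanSpace ℝ (Fin p))} (h : W' ≤ W) : preim φ W' ≤ preim φ W :=
  fun _ hx => ⟨hx.1, h hx.2⟩

/-- A chart of dimension `p|r`: an isomorphism `(φ, φ^*)` of ringed spaces between the restriction
of `X` to an open subset of `M` and a superdomain over an open subset of `ℝᵖ`, with `r d` formal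
variables of each nonzero degree `d`. -/
structure Chart (p : ℕ) (r : {d : Deg n // d ≠ 0} → ℕ) where
  /-- the number of formal variables -/
  q : ℕ
  /-- the degrees of the formal variables -/
  σ : Fin q → {d : Deg n // d ≠ 0}
  card_fiber : ∀ d, Nat.card {a // σ a = d} = r d
  /-- the homeomorphism of the bases -/
  φ : OpenPartialHomeomorph M (EuclideanSpace ℝ (Fin p))
  /-- the pullback maps `𝒪(W) → 𝒜(φ⁻¹(W))` -/
  pullback : ∀ W : Opens (EuclideanSpace ℝ (Fin p)), (W : Set _) ⊆ φ.target →
    FormalSeries (fun a => (σ a : Deg n)) (Smooth W) ≃ₐ[ℝ]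
      X.sec (preim φ W)
  pullback_mem_deg : ∀ W hW f d, pullback W hW f ∈ X.deg _ d ↔ f.HasDegree d
  pullback_restrict : ∀ {W' W : Opens (EuclideanSpace ℝ (Fin p))} (h : W' ≤ W)
    (hW : (W : Set _) ⊆ φ.target) (f),
    pullback W' (fun _ hx => hW (h hx)) (restrictSeries h f) =
      X.res (preim_mono φ h) (pullback W hW f)

/-- The image of a chart as an open set. -/
def Chart.target {X : RingedSpace.{u, v} n M} {p : ℕ} {r : {d : Deg n // d ≠ 0} → ℕ}
    (c : X.Chart p r) : Opens (EuclideanSpace ℝ (Fin p)) :=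
  ⟨c.φ.target, c.φ.open_target⟩

/-- The germ `[P]_m` of (the pullback of) a function `P = P(x, ξ)` on the image of a chart. -/
def Chart.germ {X : RingedSpace.{u, v} n M} {p : ℕ} {r : {d : Deg n // d ≠ 0} → ℕ}
    (c : X.Chart p r) {m : M} (hm : m ∈ c.φ.source)
    (P : FormalSeries (fun a => (c.σ a : Deg n)) (Smooth c.target)) : X.Stalk m :=
  X.germ (U := preim c.φ c.target) ⟨hm, c.φ.map_source hm⟩
    (c.pullback c.target subset_rfl P)

end RingedSpace

/-- A `ℤ₂ⁿ`-supermanifold of dimension `p|r` with base `M`: a second-countable Hausdorff space with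
a sheaf of `ℤ₂ⁿ`-commutative algebras, whose stalks are local (each has a unique maximal
homogeneous ideal), and which is locally isomorphic to a superdomain of dimension `p|r`. -/
structure Supermanifold (n p : ℕ) (r : {d : Deg n // d ≠ 0} → ℕ) (M : Type u)
    [TopologicalSpace M] extends RingedSpace.{u, v} n M where
  t2 : T2Space M
  secondCountable : SecondCountableTopology M
  isLocal : ∀ m : M, ∃! I : Ideal (toRingedSpace.Stalk m), toRingedSpace.IsMaximalHomogeneous I
  exists_chart : ∀ m : M, ∃ c : toRingedSpace.Chart p r, m ∈ c.φ.source

/-- The unique maximal homogeneous ideal `𝔪_m` of the stalk at `m`. -/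
def Supermanifold.maxIdeal {n p : ℕ} {r : {d : Deg n // d ≠ 0} → ℕ} {M : Type u}
    [TopologicalSpace M] (X : Supermanifold.{u, v} n p r M) (m : M) :
    Ideal (X.toRingedSpace.Stalk m) :=
  (X.isLocal m).choose

end Z2n

end

/-! Near `m`, a section of `𝒜` is a series `∑ F_μ ξ^μ` with smooth coefficients on a neighbourhood of
`x₀ = φ m`. A cutoff function equal to `1` near `x₀`, the same for all `μ`, makes the coefficients
global without changing the germ, so that taking germs is a surjective ring homomorphism
`C^∞(ℝᵖ)[[ξ]] → 𝒜_m` (`globalGerm_surjective`). As the pullback maps are injective, evaluation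
`F ↦ F_0(x₀)` descends to a ring homomorphism `value : 𝒜_m → ℝ`. Its kernel is a maximal left ideal,
two-sided, and homogeneous because the homogeneous components of a series with `F_0(x₀) = 0` have
the same property; by uniqueness it is `𝔪_m` (`maxIdeal_eq_ker_value`). In particular the germs of
the centred coordinates `x^i - x₀^i` and of the indeterminates `ξ^a` lie in `𝔪_m`.

Hadamard's lemma for `F_0`, together with sorting the other monomials by the last indeterminate they
contain, gives
`F = F_0(x₀) + ∑ i, g_i (x^i - x₀^i) + ∑ a, H_a ξ^a`
with a finite sum over `a`, although `F` may have infinitely many terms. If `g_i` and `H_a` are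
approximated by polynomial series modulo `𝔪_m ^ k`, substituting these approximations on the right
yields a polynomial series that approximates `F` modulo `𝔪_m ^ (k + 1)`; induction on `k` concludes
(`exists_polynomial_sub_mem_pow`). Polynomial series are series with coefficients in
`MvPolynomial (Fin p) ℝ`, mapped to smooth coefficients, so no closure properties of the predicate
`IsPolynomialAt` are needed. -/

noncomputable section

/-! ### Formal series: homomorphisms and division by indeterminates -/

namespace Z2n.FormalSeries

variable {n q : ℕ} {σ : Fin q → Deg n} {R : Type v} [CommRing R]

theorem admissible_zero (σ : Fin q → Deg n) : Admissible σ 0 := fun a _ => by simp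

theorem admissible_of_le {μ ν : Fin q →₀ ℕ} (h : Admissible σ μ) (hν : ν ≤ μ) :
    Admissible σ ν := fun a ha => (hν a).trans (h a ha)

@[simp] theorem coeff_sum {ι : Type*} (s : Finset ι) (F : ι → FormalSeries σ R) (μ : Fin q →₀ ℕ) :
    (∑ i ∈ s, F i).coeff μ = ∑ i ∈ s, (F i).coeff μ :=
  map_sum (AddMonoidHom.mk' (fun G : FormalSeries σ R => G.coeff μ) fun f g => coeff_add f g μ) F s

/-- Applying a ring homomorphism to the coefficients, as a ring homomorphism. -/
def mapHom {S : Type*} [CommRing S] (σ : Fin q → Deg n) (φ : R →+* S) :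
    FormalSeries σ R →+* FormalSeries σ S where
  toFun := map φ
  map_one' := by
    ext μ hμ
    change φ ((1 : FormalSeries σ R).coeff μ) = _
    rw [coeff_one hμ, coeff_one hμ]
    split_ifs <;> simp
  map_mul' f g := by
    ext μ hμ
    change φ ((f * g).coeff μ) = _
    rw [coeff_mul _ _ hμ, coeff_mul _ _ hμ, map_sum]
    simp only [map_mul, map_intCast]
    rfl
  map_zero' := by
    ext μ _
    exact map_zero φ
  map_add' f g := by
    ext μ _
    exact map_add φ _ _

theorem coeff_mapHom {S : Type*} [CommRing S] (φ : R →+* S) (f : FormalSeries σ R)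
    (μ : Fin q →₀ ℕ) : (mapHom σ φ f).coeff μ = φ (f.coeff μ) := rfl

/-- The coefficient of `ξ^0`, as a ring homomorphism. -/
def constCoeff (σ : Fin q → Deg n) (R : Type v) [CommRing R] : FormalSeries σ R →+* R where
  toFun f := f.coeff 0
  map_one' := by rw [coeff_one (admissible_zero σ), if_pos rfl]
  map_mul' f g := by
    rw [coeff_mul _ _ (admissible_zero σ)]
    simp [monoSign_zero_left]
  map_zero' := rfl
  map_add' _ _ := rfl

theorem constCoeff_apply (f : FormalSeries σ R) : constCoeff σ R f = f.coeff 0 := rfl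

theorem coeff_algebraMap (c : R) {μ : Fin q →₀ ℕ} (hμ : Admissible σ μ) :
    (algebraMap R (FormalSeries σ R) c).coeff μ = if μ = 0 then c else 0 := by
  rw [Algebra.algebraMap_eq_smul_one, coeff_smul, coeff_one hμ]
  split_ifs <;> simp

@[simp] theorem constCoeff_algebraMap (c : R) :
    constCoeff σ R (algebraMap R (FormalSeries σ R) c) = c := by
  rw [constCoeff_apply, coeff_algebraMap _ (admissible_zero σ), if_pos rfl]

/-- The indeterminate `ξ^a`. -/
def var (σ : Fin q → Deg n) (R : Type v) [CommRing R] (a : Fin q) : FormalSeries σ R :=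
  mk fun μ => if μ = Finsupp.single a 1 then 1 else 0

@[simp] theorem constCoeff_var (a : Fin q) : constCoeff σ R (var σ R a) = 0 := by
  rw [constCoeff_apply, var, coeff_mk _ (admissible_zero σ), if_neg]
  exact fun h => by simpa using DFunLike.congr_fun h a

theorem coeff_mul_var (f : FormalSeries σ R) (a : Fin q) {μ : Fin q →₀ ℕ} (hμ : Admissible σ μ) :
    (f * var σ R a).coeff μ = if μ a = 0 then 0 else
      ((monoSign σ (μ - Finsupp.single a 1) (Finsupp.single a 1) : ℤ) : R) *
        f.coeff (μ - Finsupp.single a 1) := by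
  have key : ∀ x ∈ Finset.HasAntidiagonal.antidiagonal μ, (var σ R a).coeff x.2 =
      if x.2 = Finsupp.single a 1 then 1 else 0 := fun x hx => coeff_mk _ (admissible_right hμ hx)
  rw [coeff_mul _ _ hμ]
  split_ifs with h
  · refine Finset.sum_eq_zero fun x hx => ?_
    rw [key x hx, if_neg, mul_zero]
    intro hx2
    have := DFunLike.congr_fun (Finset.HasAntidiagonal.mem_antidiagonal.1 hx) a
    simp [hx2, h] at this
  · have hle : Finsupp.single a 1 ≤ μ := by simpa [Nat.one_le_iff_ne_zero] using h
    rw [Finset.sum_eq_single (μ - Finsupp.single a 1, Finsupp.single a 1)]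
    · rw [key _ (by simpa using tsub_add_cancel_of_le hle), if_pos rfl, mul_one]
    · rintro ⟨x, y⟩ hx hne
      rw [key _ hx, if_neg, mul_zero]
      rintro rfl
      rw [Finset.HasAntidiagonal.mem_antidiagonal] at hx
      exact hne (Prod.ext (by simp [← hx]) rfl)
    · intro hx
      exact absurd (by simpa using tsub_add_cancel_of_le hle) hx

@[simp] theorem mapHom_algebraMap {S : Type*} [CommRing S] (φ : R →+* S) (c : R) :
    mapHom σ φ (algebraMap R _ c) = algebraMap S _ (φ c) := by
  ext μ hμ
  rw [coeff_mapHom, coeff_algebraMap _ hμ, coeff_algebraMap _ hμ]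
  split_ifs <;> simp

@[simp] theorem mapHom_var {S : Type*} [CommRing S] (φ : R →+* S) (a : Fin q) :
    mapHom σ φ (var σ R a) = var σ S a := by
  ext μ hμ
  rw [coeff_mapHom, var, var, coeff_mk _ hμ, coeff_mk _ hμ]
  split_ifs <;> simp

open Classical in
/-- The part of `f` whose monomials contain `ξ^a` and no later indeterminate, divided by `ξ^a` on
the right. -/
def divVar (f : FormalSeries σ R) (a : Fin q) : FormalSeries σ R :=
  mk fun ν => if ∀ b, a < b → ν b = 0 then f.coeff (ν + Finsupp.single a 1) else 0

/-- No sign arises when `ξ^a` is multiplied on the right to a monomial without later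
indeterminates. -/
theorem monoSign_single_right {ν : Fin q →₀ ℕ} {a : Fin q} (h : ∀ b, a < b → ν b = 0) :
    monoSign σ ν (Finsupp.single a 1) = 1 := by
  refine Finset.prod_eq_one fun b _ => Finset.prod_eq_one fun d _ => ?_
  split_ifs with hd
  · by_cases had : a = d
    · rw [h b (had ▸ hd), zero_mul, pow_zero]
    · rw [Finsupp.single_eq_of_ne (Ne.symm had), mul_zero, pow_zero]
  · rfl

open Classical in
/-- The monomials of `(f.divVar a) ξ^a` are those of `f` whose last indeterminate is `ξ^a`. -/
theorem coeff_divVar_mul_var (f : FormalSeries σ R) (a : Fin q) {μ : Fin q →₀ ℕ}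
    (hμ : Admissible σ μ) :
    (f.divVar a * var σ R a).coeff μ =
      if μ a ≠ 0 ∧ ∀ b, a < b → μ b = 0 then f.coeff μ else 0 := by
  rw [coeff_mul_var _ _ hμ]
  by_cases h : μ a = 0
  · simp [h]
  have hle : Finsupp.single a 1 ≤ μ := by simpa [Nat.one_le_iff_ne_zero] using h
  have hiff : (∀ b, a < b → (μ - Finsupp.single a 1 : Fin q →₀ ℕ) b = 0) ↔
      ∀ b, a < b → μ b = 0 := by
    refine forall₂_congr fun b hb => ?_
    rw [Finsupp.tsub_apply, Finsupp.single_eq_of_ne hb.ne', tsub_zero]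
  rw [if_neg h, divVar, coeff_mk _ (admissible_of_le hμ tsub_le_self), tsub_add_cancel_of_le hle]
  by_cases hb : ∀ b, a < b → μ b = 0
  · rw [if_pos (hiff.2 hb), if_pos ⟨h, hb⟩, monoSign_single_right (hiff.2 hb)]
    simp
  · rw [if_neg (mt hiff.1 hb), if_neg (fun h' => hb h'.2), mul_zero]

/-- Splitting off the constant term, and sorting the remaining monomials by the last indeterminate
they contain. -/
theorem eq_const_add_sum_mul_var (f : FormalSeries σ R) :
    f = algebraMap R _ (constCoeff σ R f) + ∑ a, f.divVar a * var σ R a := by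
  classical
  ext μ hμ
  rw [coeff_add, coeff_sum, coeff_algebraMap _ hμ,
    Finset.sum_congr rfl fun a _ => coeff_divVar_mul_var f a hμ]
  by_cases h : μ = 0
  · simp [h, constCoeff_apply]
  · have hne : μ.support.Nonempty := Finsupp.support_nonempty_iff.2 h
    have hmax : ∀ a, (μ a ≠ 0 ∧ ∀ b, a < b → μ b = 0) ↔ a = μ.support.max' hne := by
      intro a
      constructor
      · rintro ⟨h1, h2⟩
        refine le_antisymm (Finset.le_max' _ _ (by simpa using h1)) (not_lt.1 fun hlt => ?_)
        exact (by simpa using Finset.max'_mem _ hne : μ (μ.support.max' hne) ≠ 0) (h2 _ hlt)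
      · rintro rfl
        refine ⟨by simpa using Finset.max'_mem _ hne, fun b hb => ?_⟩
        by_contra hb0
        exact absurd (Finset.le_max' _ b (by simpa using hb0)) (not_le.2 hb)
    rw [if_neg h, zero_add, Finset.sum_eq_single (μ.support.max' hne)]
    · rw [if_pos ((hmax _).2 rfl)]
    · intro b _ hb
      rw [if_neg (mt (hmax b).1 hb)]
    · simp

/-! ### Homogeneous components of formal series -/

open Classical in
/-- The homogeneous component of degree `d`. -/
def component (f : FormalSeries σ R) (d : Deg n) : FormalSeries σ R :=
  mk fun μ => if ∑ a, μ a • σ a = d then f.coeff μ else 0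

open Classical in
theorem coeff_component (f : FormalSeries σ R) (d : Deg n) (μ : Fin q →₀ ℕ) :
    (f.component d).coeff μ = if ∑ a, μ a • σ a = d then f.coeff μ else 0 := by
  by_cases h : Admissible σ μ
  · rw [component, coeff_mk _ h]
  · rw [coeff_of_not_admissible _ h, coeff_of_not_admissible _ h, ite_self]

theorem hasDegree_component (f : FormalSeries σ R) (d : Deg n) : (f.component d).HasDegree d := by
  intro μ h
  by_contra hd
  exact h (by rw [coeff_component, if_neg hd])

theorem sum_component (f : FormalSeries σ R) : ∑ d, f.component d = f := by
  ext μ _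
  rw [coeff_sum, Finset.sum_congr rfl fun d _ => coeff_component f d μ]
  simp

theorem HasDegree.mapHom {S : Type*} [CommRing S] {f : FormalSeries σ R} {d : Deg n}
    (h : f.HasDegree d) (φ : R →+* S) : (mapHom σ φ f).HasDegree d := fun μ hμ =>
  h μ fun h0 => hμ (by rw [coeff_mapHom, h0, map_zero])

end Z2n.FormalSeries

/-! ### Smooth functions: Hadamard's lemma and extension by cutoff -/

namespace Z2n

/-- The integral over `[0, 1]` of a function depending smoothly on a parameter is smooth. -/
theorem contDiff_intervalIntegral_param {E : Type*} [NormedAddCommGroup E] [NormedSpace ℝ E]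
    {h : E → ℝ → ℝ} (hh : ContDiff ℝ ∞ fun z : E × ℝ => h z.1 z.2) :
    ContDiff ℝ ∞ fun x => ∫ t in (0 : ℝ)..1, h x t := by
  let χ : ContDiffBump (0 : ℝ) := ⟨2, 3, by norm_num, by norm_num⟩
  -- The integral is the value at `0` of the convolution of the indicator function of `[0, 1]`
  -- with the reflection of `h x`, which may be cut off far from `[0, 1]`.
  have key : ∀ x, ∫ t in (0 : ℝ)..1, h x t =
      MeasureTheory.convolution (Set.indicator (Set.Ioc (0 : ℝ) 1) fun _ => (1 : ℝ))
        (fun s => χ s * h x (-s)) (ContinuousLinearMap.mul ℝ ℝ) MeasureTheory.volume 0 := by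
    intro x
    rw [intervalIntegral.integral_of_le zero_le_one, MeasureTheory.convolution,
      ← MeasureTheory.integral_indicator measurableSet_Ioc]
    refine MeasureTheory.integral_congr_ae (Filter.Eventually.of_forall fun t => ?_)
    by_cases ht : t ∈ Set.Ioc (0 : ℝ) 1
    · have : χ (-t) = 1 := χ.one_of_mem_closedBall (by
        rw [mem_closedBall_zero_iff, norm_neg, Real.norm_eq_abs, abs_of_pos ht.1]
        exact ht.2.trans (by norm_num [χ]))
      simp [ht, this]
    · simp [ht]
  simp only [key]
  rw [← contDiffOn_univ]
  refine MeasureTheory.contDiffOn_convolution_right_with_param_comp (n := ⊤)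
    (k := Metric.closedBall (0 : ℝ) 3) _ contDiffOn_const isOpen_univ (isCompact_closedBall _ _) ?_ ?_ ?_
  · intro x s _ hs
    have : χ s = 0 := χ.zero_of_le_dist (by
      rw [Metric.mem_closedBall, not_le] at hs
      exact hs.le)
    rw [this, zero_mul]
  · exact ((MeasureTheory.locallyIntegrable_const (1 : ℝ)).indicator measurableSet_Ioc)
  · refine ContDiff.contDiffOn ?_
    exact (χ.contDiff.comp contDiff_snd).mul
      (hh.comp (contDiff_fst.prodMk contDiff_snd.neg))

/-- Hadamard's lemma: `g i` is the integral of the `i`-th partial derivative of `f` along the segment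
from `x₀`. -/
theorem exists_hadamard {p : ℕ} {f : EuclideanSpace ℝ (Fin p) → ℝ} (hf : ContDiff ℝ ∞ f)
    (x₀ : EuclideanSpace ℝ (Fin p)) :
    ∃ g : Fin p → EuclideanSpace ℝ (Fin p) → ℝ, (∀ i, ContDiff ℝ ∞ (g i)) ∧
      ∀ x, f x = f x₀ + ∑ i, (x i - x₀ i) * g i x := by
  let e : Fin p → EuclideanSpace ℝ (Fin p) := fun i => EuclideanSpace.single i 1
  have hsm : ∀ v, ContDiff ℝ ∞ fun z : EuclideanSpace ℝ (Fin p) × ℝ =>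
      fderiv ℝ f (x₀ + z.2 • (z.1 - x₀)) v := fun v =>
    ((hf.fderiv_right (m := ∞) le_rfl).comp
      (contDiff_const.add (contDiff_snd.smul (contDiff_fst.sub contDiff_const)))).clm_apply
      contDiff_const
  refine ⟨fun i x => ∫ t in (0 : ℝ)..1, fderiv ℝ f (x₀ + t • (x - x₀)) (e i), fun i =>
    contDiff_intervalIntegral_param (hsm (e i)), fun x => ?_⟩
  have hint : ∀ v, IntervalIntegrable (fun t : ℝ => fderiv ℝ f (x₀ + t • (x - x₀)) v)
      MeasureTheory.volume 0 1 := fun v =>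
    ((hsm v).continuous.comp
      (continuous_const.prodMk continuous_id : Continuous fun t : ℝ => (x, t))).intervalIntegrable
        _ _
  have hftc : ∫ t in (0 : ℝ)..1, fderiv ℝ f (x₀ + t • (x - x₀)) (x - x₀) = f x - f x₀ := by
    rw [intervalIntegral.integral_eq_sub_of_hasDerivAt (f := fun t : ℝ => f (x₀ + t • (x - x₀)))
      (fun t _ => ?_) (hint _)]
    · simp
    · have h1 : HasDerivAt (fun t : ℝ => x₀ + t • (x - x₀)) (x - x₀) t := by
        simpa using ((hasDerivAt_id t).smul_const (x - x₀)).const_add x₀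
      exact ((hf.differentiable (by simp)).differentiableAt.hasFDerivAt).comp_hasDerivAt t h1
  have hsum : x - x₀ = ∑ i, (x i - x₀ i) • e i := by
    ext j
    simp [e, Pi.single_apply]
  have hexp : ∀ L : EuclideanSpace ℝ (Fin p) →L[ℝ] ℝ,
      L (x - x₀) = ∑ i, (x i - x₀ i) * L (e i) := by
    intro L
    rw [hsum, map_sum]
    simp
  simp only [hexp] at hftc
  rw [intervalIntegral.integral_finsetSum fun i _ => (hint _).const_mul _] at hftc
  simp only [intervalIntegral.integral_const_mul] at hftc
  linarith

/-- The ring `C^∞(ℝᵖ)` of globally defined smooth functions. -/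
abbrev GlobalSmooth (p : ℕ) : Type :=
  ContMDiffMap (𝓡 p) 𝓘(ℝ, ℝ) (EuclideanSpace ℝ (Fin p)) ℝ ∞

/-- Restriction `C^∞(ℝᵖ) → C^∞(W)`. -/
def restrictGlobal {p : ℕ} (W : Opens (EuclideanSpace ℝ (Fin p))) :
    GlobalSmooth p →+* Smooth W where
  toFun f := ⟨fun x => f x, f.contMDiff.comp contMDiff_subtype_val⟩
  map_one' := rfl
  map_mul' _ _ := rfl
  map_zero' := rfl
  map_add' _ _ := rfl

/-- Smooth functions on `W` extend to all of `ℝᵖ` after shrinking `W` to a neighbourhood of `x₀`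
that does not depend on the function. -/
theorem exists_globalSmooth_eqOn {p : ℕ} {W : Opens (EuclideanSpace ℝ (Fin p))}
    {x₀ : EuclideanSpace ℝ (Fin p)} (hx : x₀ ∈ W) :
    ∃ (W' : Opens (EuclideanSpace ℝ (Fin p))) (h : W' ≤ W), x₀ ∈ W' ∧
      ∀ f : Smooth W, ∃ F : GlobalSmooth p,
        restrictGlobal W' F = ContMDiffMap.restrictRingHom (𝓡 p) 𝓘(ℝ, ℝ) ℝ h f := by
  obtain ⟨δ, hδ, hball⟩ := Metric.nhds_basis_closedBall.mem_iff.1 (W.isOpen.mem_nhds hx)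
  let χ : ContDiffBump x₀ := ⟨δ / 2, δ, by positivity, by linarith⟩
  have hsub : Metric.ball x₀ (δ / 2) ⊆ W := fun x hx => hball
    (Metric.ball_subset_closedBall (Metric.ball_subset_ball (by linarith) hx))
  refine ⟨⟨Metric.ball x₀ (δ / 2), Metric.isOpen_ball⟩, hsub, Metric.mem_ball_self (by positivity),
    fun f => ?_⟩
  let g : EuclideanSpace ℝ (Fin p) → ℝ := Function.extend Subtype.val f 0
  have hg : ∀ x : W, g x = f x := fun x => Subtype.val_injective.extend_apply _ _ x
  have hsm : ContMDiff (𝓡 p) 𝓘(ℝ, ℝ) ∞ fun x => χ x * g x := by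
    intro x
    by_cases hxW : x ∈ W
    · refine χ.contDiff.contMDiff.contMDiffAt.mul ?_
      have h1 : ContMDiffAt (𝓡 p) 𝓘(ℝ, ℝ) ∞ (fun y : W => g y) ⟨x, hxW⟩ := by
        simp only [hg]
        exact f.contMDiff.contMDiffAt
      exact contMDiffAt_subtype_iff.1 h1
    · have hx' : x ∉ tsupport χ := fun h => hxW (hball (χ.tsupport_eq ▸ h))
      refine (contMDiffAt_const (c := (0 : ℝ))).congr_of_eventuallyEq ?_
      filter_upwards [notMem_tsupport_iff_eventuallyEq.1 hx'] with y hy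
      simp [hy]
  refine ⟨⟨_, hsm⟩, ?_⟩
  ext x
  change χ x * g x = f ⟨x, hsub x.2⟩
  rw [χ.one_of_mem_closedBall (Metric.ball_subset_closedBall x.2), one_mul]
  exact hg ⟨x, hsub x.2⟩

/-- The function `x^i - x₀^i`. -/
def centredCoord {p : ℕ} (x₀ : EuclideanSpace ℝ (Fin p)) (i : Fin p) : GlobalSmooth p :=
  ⟨fun x => x i - x₀ i, by
    refine ContDiff.contMDiff (ContDiff.sub ?_ contDiff_const)
    exact (EuclideanSpace.proj (𝕜 := ℝ) i).contDiff⟩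

/-- A polynomial in the centred coordinates `x - x₀`, as a smooth function. -/
def polyFun {p : ℕ} (x₀ : EuclideanSpace ℝ (Fin p)) : MvPolynomial (Fin p) ℝ →+* GlobalSmooth p :=
  (MvPolynomial.aeval (centredCoord x₀) : _ →ₐ[ℝ] _)

theorem polyFun_X {p : ℕ} (x₀ : EuclideanSpace ℝ (Fin p)) (i : Fin p) :
    polyFun x₀ (MvPolynomial.X i) = centredCoord x₀ i := MvPolynomial.aeval_X _ _

theorem polyFun_apply {p : ℕ} (x₀ : EuclideanSpace ℝ (Fin p)) (Q : MvPolynomial (Fin p) ℝ)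
    (x : EuclideanSpace ℝ (Fin p)) :
    polyFun x₀ Q x = MvPolynomial.eval (fun i => x i - x₀ i) Q := by
  have : (ContMDiffMap.evalRingHom x).comp (polyFun x₀) =
      MvPolynomial.eval (fun i => x i - x₀ i) := by
    apply MvPolynomial.ringHom_ext
    · intro t
      rw [RingHom.comp_apply, MvPolynomial.eval_C]
      change MvPolynomial.aeval (centredCoord x₀) (MvPolynomial.C t) x = t
      rw [MvPolynomial.aeval_C]
      rfl
    · intro i
      rw [RingHom.comp_apply, MvPolynomial.eval_X, polyFun_X]
      rfl
  exact RingHom.congr_fun this Q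

/-- Hadamard's lemma in the ring of smooth functions. -/
theorem exists_eq_const_add_sum_mul_centredCoord {p : ℕ} (f : GlobalSmooth p)
    (x₀ : EuclideanSpace ℝ (Fin p)) :
    ∃ g : Fin p → GlobalSmooth p,
      f = polyFun x₀ (MvPolynomial.C (f x₀)) + ∑ i, g i * centredCoord x₀ i := by
  obtain ⟨g, hg, hfg⟩ := exists_hadamard f.contMDiff.contDiff x₀
  refine ⟨fun i => ⟨g i, (hg i).contMDiff⟩, ?_⟩
  ext x
  have hev : ∀ h : GlobalSmooth p, h x = ContMDiffMap.evalRingHom x h := fun _ => rfl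
  rw [hfg x, hev (_ + _), map_add, map_sum]
  congr 1
  · exact (by rw [polyFun_apply, MvPolynomial.eval_C] :
      polyFun x₀ (MvPolynomial.C (f x₀)) x = f x₀).symm
  · exact Finset.sum_congr rfl fun i _ => mul_comm _ _

/-! ### Stalks -/

namespace RingedSpace

variable {n : ℕ} {M : Type u} [TopologicalSpace M] (X : RingedSpace.{u, v} n M)

/-- Taking germs at `m`, as a ring homomorphism. -/
def germHom {U : Opens M} {m : M} (hm : m ∈ U) : X.sec U →+* X.Stalk m where
  toFun := X.germ hm
  map_one' := (DirectLimit.one_def (f := X.nhdsRes m) _).symm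
  map_mul' _ _ := (DirectLimit.mul_def (f := X.nhdsRes m) _ _ _).symm
  map_zero' := (DirectLimit.zero_def (f := X.nhdsRes m) _).symm
  map_add' _ _ := (DirectLimit.add_def (f := X.nhdsRes m) _ _ _).symm

variable {X}

theorem germ_res {U V : Opens M} (h : U ≤ V) {m : M} (hm : m ∈ U) (f : X.sec V) :
    X.germ hm (X.res h f) = X.germ (h hm) f :=
  (DirectLimit.eq_of_le (f := X.nhdsRes m)
    (⟨OrderDual.toDual (⟨V, h hm⟩ : OpenNhdsOf m), f⟩ : Σ U, X.nhdsSec m U)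
    (OrderDual.toDual (⟨U, hm⟩ : OpenNhdsOf m)) h).symm

theorem exists_res_eq_of_germ_eq {U : Opens M} {m : M} (hm : m ∈ U) {f g : X.sec U}
    (h : X.germ hm f = X.germ hm g) :
    ∃ (V : Opens M) (hV : V ≤ U), m ∈ V ∧ X.res hV f = X.res hV g := by
  obtain ⟨V, hV, _, h⟩ := Quotient.exact h
  exact ⟨(OrderDual.ofDual V).toOpens, hV, (OrderDual.ofDual V).mem, h⟩

theorem exists_germ_eq {m : M} (a : X.Stalk m) :
    ∃ (U : Opens M) (hm : m ∈ U) (f : X.sec U), X.germ hm f = a := by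
  obtain ⟨U, f, rfl⟩ := DirectLimit.exists_eq_mk _ a
  exact ⟨(OrderDual.ofDual U).toOpens, (OrderDual.ofDual U).mem, f, rfl⟩

/-! ### Germs of series in the coordinates of a chart -/

namespace Chart

variable {p : ℕ} {r : {d : Deg n // d ≠ 0} → ℕ} (c : X.Chart p r) {m : M}

/-- The ring `C^∞(ℝᵖ)[[ξ]]` in the formal variables of a chart. -/
abbrev GlobalSeries : Type := FormalSeries (fun a => (c.σ a : Deg n)) (GlobalSmooth p)

/-- The germ at `m` of the pullback of a series with coefficients in `C^∞(ℝᵖ)`. -/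
def globalGerm (hm : m ∈ c.φ.source) : c.GlobalSeries →+* X.Stalk m :=
  ((X.germHom (U := preim c.φ c.target) ⟨hm, c.φ.map_source hm⟩).comp
    (c.pullback c.target subset_rfl : _ →+* _)).comp
    (FormalSeries.mapHom _ (restrictGlobal c.target))

/-- Evaluation of the coefficient of `ξ^0` at the image of `m`. -/
def eval (m : M) : c.GlobalSeries →+* ℝ :=
  (ContMDiffMap.evalRingHom (c.φ m)).comp (FormalSeries.constCoeff _ _)

theorem eval_apply (F : c.GlobalSeries) : c.eval m F = F.coeff 0 (c.φ m) := rfl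

theorem germ_pullback_restrict {W W' : Opens (EuclideanSpace ℝ (Fin p))} (h : W' ≤ W)
    (hW : (W : Set _) ⊆ c.φ.target) (hm : m ∈ c.φ.source) (hx : c.φ m ∈ W')
    (F : FormalSeries (fun a => (c.σ a : Deg n)) (Smooth W)) :
    X.germ (U := preim c.φ W') ⟨hm, hx⟩
        (c.pullback W' (fun _ hx => hW (h hx)) (restrictSeries h F)) =
      X.germ (U := preim c.φ W) ⟨hm, h hx⟩ (c.pullback W hW F) := by
  rw [c.pullback_restrict h hW]
  exact germ_res _ _ _

theorem globalGerm_eq (hm : m ∈ c.φ.source) {W : Opens (EuclideanSpace ℝ (Fin p))}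
    (hW : W ≤ c.target) (hx : c.φ m ∈ W) (F : c.GlobalSeries) :
    c.globalGerm hm F = X.germ (U := preim c.φ W) ⟨hm, hx⟩
      (c.pullback W hW (FormalSeries.mapHom _ (restrictGlobal W) F)) :=
  (c.germ_pullback_restrict hW subset_rfl hm hx _).symm

/-- A neighbourhood of `m` contains the preimage of a neighbourhood of the image of `m`. -/
theorem exists_preim_le (hm : m ∈ c.φ.source) {U : Opens M} (hU : m ∈ U) :
    ∃ W : Opens (EuclideanSpace ℝ (Fin p)), W ≤ c.target ∧ c.φ m ∈ W ∧ preim c.φ W ≤ U := by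
  refine ⟨⟨c.φ.target ∩ c.φ.symm ⁻¹' U, c.φ.symm.isOpen_inter_preimage U.isOpen⟩,
    fun x hx => hx.1, ⟨c.φ.map_source hm, ?_⟩, fun y hy => ?_⟩
  · simpa [c.φ.left_inv hm] using hU
  · simpa [c.φ.left_inv hy.1] using hy.2.2

/-- Every germ comes from a series with globally defined smooth coefficients. -/
theorem globalGerm_surjective (hm : m ∈ c.φ.source) : Function.Surjective (c.globalGerm hm) := by
  intro a
  obtain ⟨U, hU, f, rfl⟩ := exists_germ_eq a
  obtain ⟨W, hW, hx, hWU⟩ := c.exists_preim_le hm hU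
  obtain ⟨W', hW', hx', hext⟩ := exists_globalSmooth_eqOn hx
  choose ext hext using hext
  -- The extensions agree with the coefficients on a common neighbourhood `W'`, which is what allows
  -- infinitely many coefficients.
  let F := (c.pullback W hW).symm (X.res hWU f)
  refine ⟨FormalSeries.mk fun μ => ext (F.coeff μ), ?_⟩
  have h1 : FormalSeries.mapHom (fun a => (c.σ a : Deg n)) (restrictGlobal W')
      (FormalSeries.mk fun μ => ext (F.coeff μ)) = restrictSeries hW' F := by
    apply FormalSeries.ext
    intro μ hμ
    rw [FormalSeries.coeff_mapHom, FormalSeries.coeff_mk _ hμ, hext]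
    rfl
  rw [c.globalGerm_eq hm (hW'.trans hW) hx', h1, c.germ_pullback_restrict hW' hW hm hx',
    AlgEquiv.apply_symm_apply]
  exact germ_res _ _ _

/-- The value at the image of `m` of the constant coefficient of a series depends only on its germ. -/
theorem ker_globalGerm_le (hm : m ∈ c.φ.source) :
    RingHom.ker (c.globalGerm hm) ≤ RingHom.ker (c.eval m) := by
  intro F hF
  rw [RingHom.mem_ker] at hF ⊢
  obtain ⟨V, hV, hmV, hres⟩ := exists_res_eq_of_germ_eq _
    (hF.trans (map_zero (X.germHom (U := preim c.φ c.target) ⟨hm, c.φ.map_source hm⟩)).symm)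
  obtain ⟨W, hW, hx, hWV⟩ := c.exists_preim_le hm hmV
  have h0 : c.pullback W hW (FormalSeries.mapHom _ (restrictGlobal W) F) = 0 := by
    refine (c.pullback_restrict hW subset_rfl
      (FormalSeries.mapHom _ (restrictGlobal c.target) F)).trans ?_
    have := congrArg (X.res hWV) hres
    rwa [map_zero, map_zero, X.res_res] at this
  rw [map_eq_zero_iff _ (c.pullback W hW).injective] at h0
  exact congrArg (fun G : FormalSeries (fun a => (c.σ a : Deg n)) (Smooth W) =>
    G.coeff 0 ⟨c.φ m, hx⟩) h0

/-! ### The maximal homogeneous ideal of a stalk -/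

/-- The value at `m` of a germ: the constant coefficient of a representing series, evaluated at
the image of `m`. -/
def value (hm : m ∈ c.φ.source) : X.Stalk m →+* ℝ :=
  (c.globalGerm hm).liftOfSurjective (c.globalGerm_surjective hm)
    ⟨c.eval m, c.ker_globalGerm_le hm⟩

theorem value_globalGerm (hm : m ∈ c.φ.source) (F : c.GlobalSeries) :
    c.value hm (c.globalGerm hm F) = c.eval m F :=
  RingHom.liftOfSurjective_comp_apply _ _ ⟨c.eval m, c.ker_globalGerm_le hm⟩ F

theorem eval_algebraMap (m : M) (f : GlobalSmooth p) :
    c.eval m (algebraMap _ _ f) = f (c.φ m) := by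
  rw [eval, RingHom.comp_apply, FormalSeries.constCoeff_algebraMap]
  rfl

theorem value_surjective (hm : m ∈ c.φ.source) : Function.Surjective (c.value hm) := fun t =>
  ⟨c.globalGerm hm (algebraMap _ _ (ContMDiffMap.const t)), by
    rw [value_globalGerm, eval_algebraMap]; rfl⟩

theorem eval_component (m : M) {F : c.GlobalSeries} (hF : c.eval m F = 0) (d : Deg n) :
    c.eval m (F.component d) = 0 := by
  rw [eval_apply] at hF ⊢
  rw [FormalSeries.coeff_component]
  split_ifs
  · exact hF
  · rfl

theorem isHomogeneousGerm_globalGerm (hm : m ∈ c.φ.source) {F : c.GlobalSeries} {d : Deg n}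
    (hF : F.HasDegree d) : X.IsHomogeneousGerm (c.globalGerm hm F) :=
  ⟨_, _, d, _, (c.pullback_mem_deg c.target subset_rfl _ d).2 (hF.mapHom _), rfl⟩

/-- The germs of value zero form a maximal homogeneous ideal: they even form a maximal left ideal,
and the homogeneous components of a series of value zero have value zero. -/
theorem isMaximalHomogeneous_ker_value (hm : m ∈ c.φ.source) :
    X.IsMaximalHomogeneous (RingHom.ker (c.value hm)) := by
  have hmax : (RingHom.ker (c.value hm)).IsMaximal :=
    RingHom.ker_isMaximal_of_surjective _ (c.value_surjective hm)
  refine ⟨⟨⟨inferInstance, le_antisymm (fun a ha => ?_) (Ideal.span_le.2 fun a ha => ha.1)⟩,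
    hmax.ne_top⟩, fun J hJ hle => (hmax.eq_of_le hJ.2 hle).ge⟩
  obtain ⟨F, rfl⟩ := c.globalGerm_surjective hm a
  rw [RingHom.mem_ker, value_globalGerm] at ha
  rw [← F.sum_component, map_sum]
  refine Ideal.sum_mem _ fun d _ => Ideal.subset_span ⟨?_, ?_⟩
  · rw [RingHom.mem_ker, value_globalGerm, c.eval_component m ha]
  · exact c.isHomogeneousGerm_globalGerm hm (F.hasDegree_component d)

end Chart

end RingedSpace

theorem Supermanifold.maxIdeal_eq_ker_value {n p : ℕ} {r : {d : Deg n // d ≠ 0} → ℕ} {M : Type u}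
    [TopologicalSpace M] (X : Supermanifold.{u, v} n p r M) {m : M} (c : X.Chart p r)
    (hm : m ∈ c.φ.source) : X.maxIdeal m = RingHom.ker (c.value hm) :=
  ((X.isLocal m).choose_spec.2 _ (c.isMaximalHomogeneous_ker_value hm)).symm

/-! ### Polynomial approximation -/

/-- Modulo each power of the ideal of germs of value zero, the germ of a series with smooth
coefficients is that of a series with polynomial coefficients. -/
theorem RingedSpace.Chart.exists_polynomial_sub_mem_pow {n p : ℕ} {M : Type u} [TopologicalSpace M]
    {X : RingedSpace.{u, v} n M} {r : {d : Deg n // d ≠ 0} → ℕ} (c : X.Chart p r) {m : M}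
    (hm : m ∈ c.φ.source) (k : ℕ) (F : c.GlobalSeries) :
    ∃ P : FormalSeries (fun a => (c.σ a : Deg n)) (MvPolynomial (Fin p) ℝ),
      c.globalGerm hm F - c.globalGerm hm (FormalSeries.mapHom _ (polyFun (c.φ m)) P) ∈
        RingHom.ker (c.value hm) ^ k := by
  induction k generalizing F with
  | zero => exact ⟨0, by simp [Submodule.pow_zero]⟩
  | succ k ih =>
    obtain ⟨g, hg⟩ := exists_eq_const_add_sum_mul_centredCoord
      (FormalSeries.constCoeff _ _ F) (c.φ m)
    choose P hP using fun i => ih (algebraMap _ _ (g i))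
    choose Q hQ using fun a => ih (F.divVar a)
    have hF := F.eq_const_add_sum_mul_var
    rw [hg] at hF
    let P' : FormalSeries (fun a => (c.σ a : Deg n)) (MvPolynomial (Fin p) ℝ) :=
      algebraMap (MvPolynomial (Fin p) ℝ) _
          (MvPolynomial.C (FormalSeries.constCoeff _ _ F (c.φ m))) +
        ∑ i, P i * algebraMap (MvPolynomial (Fin p) ℝ) _ (MvPolynomial.X i) +
        ∑ a, Q a * FormalSeries.var _ _ a
    refine ⟨P', ?_⟩
    have hcoord : ∀ i, c.globalGerm hm (algebraMap _ _ (centredCoord (c.φ m) i)) ∈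
        RingHom.ker (c.value hm) := fun i => by
      rw [RingHom.mem_ker, c.value_globalGerm, c.eval_algebraMap]
      exact sub_self _
    have hvar : ∀ a, c.globalGerm hm (FormalSeries.var _ _ a) ∈ RingHom.ker (c.value hm) :=
      fun a => by
        rw [RingHom.mem_ker, c.value_globalGerm, eval, RingHom.comp_apply,
          FormalSeries.constCoeff_var, map_zero]
    have hdiff : c.globalGerm hm F -
          c.globalGerm hm (FormalSeries.mapHom _ (polyFun (c.φ m)) P') =
        ∑ i, (c.globalGerm hm (algebraMap _ _ (g i)) -
            c.globalGerm hm (FormalSeries.mapHom _ (polyFun (c.φ m)) (P i))) *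
          c.globalGerm hm (algebraMap _ _ (centredCoord (c.φ m) i)) +
        ∑ a, (c.globalGerm hm (F.divVar a) -
            c.globalGerm hm (FormalSeries.mapHom _ (polyFun (c.φ m)) (Q a))) *
          c.globalGerm hm (FormalSeries.var _ _ a) := by
      conv_lhs => rw [hF]
      simp only [P', map_add, map_sum, map_mul, FormalSeries.mapHom_algebraMap,
        FormalSeries.mapHom_var, polyFun_X, sub_mul, Finset.sum_sub_distrib]
      abel
    -- Powers of left ideals satisfy `I ^ (k + 1) = I ^ k * I`, so the factors in `I` stand on the
    -- right.
    rw [hdiff, Submodule.pow_succ]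
    exact add_mem
      (sum_mem fun i _ => Ideal.mul_mem_mul (hP i) (hcoord i))
      (sum_mem fun a _ => Ideal.mul_mem_mul (hQ a) (hvar a))

end Z2n

end

theorem theorem6p10 {n p : ℕ} {r : {d : Z2n.Deg n // d ≠ 0} → ℕ}
    {M : Type u} [TopologicalSpace M] (X : Z2n.Supermanifold.{u, v} n p r M)
    (m : M) (c : X.Chart p r) (hc : m ∈ c.φ.source)
    (U : TopologicalSpace.Opens M) (hm : m ∈ U) (f : X.sec U) (k : ℕ) (hk : 1 ≤ k) :
    ∃ P : Z2n.FormalSeries (fun a => (c.σ a : Z2n.Deg n)) (Z2n.Smooth c.target),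
      Z2n.IsPolynomialAt (c.φ m) P ∧
      X.germ hm f - c.germ hc P ∈ (X.maxIdeal m) ^ k := by
  obtain ⟨F, hF⟩ := c.globalGerm_surjective hc (X.germ hm f)
  obtain ⟨P, hP⟩ := c.exists_polynomial_sub_mem_pow hc k F
  rw [hF, ← X.maxIdeal_eq_ker_value c hc] at hP
  refine ⟨Z2n.FormalSeries.mapHom _ (Z2n.restrictGlobal c.target)
    (Z2n.FormalSeries.mapHom _ (Z2n.polyFun (c.φ m)) P), fun μ => ⟨P.coeff μ, fun x => ?_⟩, hP⟩
  exact Z2n.polyFun_apply _ _ _
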